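/- A groupoid is a set $A$ with one binary operation $(x,y)\mapsto xy$, not assumed to satisfy any law; its dual $\mathbb A^d$ has the operation $(x,y)\mapsto yx$. The clone of $\mathbb A$ is the set of all its term functions; $\mathbb A$ has a minimal clone if this clone is an atom of the lattice of all clones on $A$ (its least element being the clone of projections). The associative spectrum is the sequence $s_{\mathbb A}(n)$, the number of different term functions on $\mathbb A$ arising from the bracketings of $x_1\cdot\ldots\cdot x_n$. Define varieties of groupoids as follows: - $\mathcal A$ by $x(y(zu))\approx x((yz)u)$; - $\mathcal B$ by $xx\approx x$ and $x(xy)\approx x(yx)\approx (xy)x\approx (xy)y\approx (xy)(yx)\approx xy$; - $\mathcal C_p$ by $xx\approx x$, $x(yz)\approx xy$, $(xy)z\approx (xz)y$ and $(\cdots((xy)y)\cdots)y\approx x$ with $p$ factors $y$; - $\mathcal D$ by $x(yx)\approx (xy)x\approx (xy)y\approx (xy)(yx)\approx xy$ and $x\cdot\bigl((\cdots(xy_1)\cdots)y_n\bigr)\approx x$ for all $n\ge 0$. Theorem. For a groupoid $\mathbb A$ the following two conditions are equivalent: (i) $\mathbb A$ is idempotent ($xx\approx x$), $\mathbb A$ has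 a minimal clone, and $1<s_{\mathbb A}(4)<5$; (ii) $\mathbb A$ is not a semigroup, and $\mathbb A$ or its dual belongs to one of the varieties $\mathcal B\cap\mathcal A$, $\mathcal C_p$ for some prime $p$, or $\mathcal D\cap\mathcal A$. If these conditions are fulfilled, then $s_{\mathbb A}(n)=2^{n-2}$ for all $n\ge 2$. -/

import Mathlib

namespace MinClone

/-! A groupoid is a type `A` with `[Mul A]`, no laws assumed. Its dual is `Aᵐᵒᵖ`, whose product is
`op x * op y = op (y * x)`. Groupoid terms in the variables `α` are the elements of the free magma
`FreeMagma α`. -/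

/-- A clone on `A`: a set of finitary operations on `A` (of arities `n ≥ 1`) that contains all
projections and is closed under composition. -/
@[ext]
structure Clone (A : Type*) where
  /-- The `n`-ary members of the clone. -/
  ops : ∀ n : ℕ, Set ((Fin n → A) → A)
  pos : ∀ {n : ℕ} {f : (Fin n → A) → A}, f ∈ ops n → 0 < n
  proj_mem : ∀ {n : ℕ} (i : Fin n), (fun v : Fin n → A => v i) ∈ ops n
  comp_mem : ∀ {m n : ℕ} {f : (Fin m → A) → A} {g : Fin m → (Fin n → A) → A},
    0 < n → f ∈ ops m → (∀ i, g i ∈ ops n) → (fun v => f (fun i => g i v)) ∈ ops n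

/-- Clones on `A` are ordered by inclusion. -/
instance (A : Type*) : PartialOrder (Clone A) where
  le C D := ∀ n, C.ops n ⊆ D.ops n
  le_refl _ _ := subset_rfl
  le_trans _ _ _ h₁ h₂ n := (h₁ n).trans (h₂ n)
  le_antisymm _ _ h₁ h₂ := Clone.ext (funext fun n => (h₁ n).antisymm (h₂ n))

/-- The trivial clone, consisting of all projections, is the least clone. -/
instance (A : Type*) : OrderBot (Clone A) where
  bot :=
    { ops := fun n => Set.range fun (i : Fin n) (v : Fin n → A) => v i
      pos := by
        rintro n f ⟨i, -⟩
        exact i.pos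
      proj_mem := fun i => ⟨i, rfl⟩
      comp_mem := by
        rintro m n f g - ⟨i, rfl⟩ hg
        exact hg i }
  bot_le C := by
    rintro n f ⟨i, rfl⟩
    exact C.proj_mem i

/-- The term function on `A` induced by a groupoid term in the variables `x_0, …, x_{n-1}`. -/
def termFun (A : Type*) [Mul A] {n : ℕ} (t : FreeMagma (Fin n)) (v : Fin n → A) : A :=
  FreeMagma.lift v t

/-- The clone of the groupoid `A`: all term functions. -/
def cloneOf (A : Type*) [Mul A] : Clone A where
  ops n := Set.range (termFun A (n := n))
  pos := by
    rintro n f ⟨t, -⟩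
    have h : ∀ t : FreeMagma (Fin n), 0 < n := by
      intro t
      induction t with
      | ih1 i => exact i.pos
      | ih2 _ _ h _ => exact h
    exact h t
  proj_mem i := ⟨FreeMagma.of i, rfl⟩
  comp_mem := by
    rintro m n f g - ⟨t, rfl⟩ hg
    choose s hs using hg
    refine ⟨FreeMagma.lift s t, ?_⟩
    funext v
    have key : ∀ t : FreeMagma (Fin m),
        termFun A (FreeMagma.lift s t) v = termFun A t (fun i => g i v) := by
      intro t
      induction t with
      | ih1 i => exact congrFun (hs i) v
      | ih2 a b ha hb =>
        simp only [termFun, map_mul] at ha hb ⊢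
        rw [ha, hb]
    exact key t

/-- `A` has a minimal clone: its clone is an atom of the lattice of all clones on `A`. -/
def HasMinimalClone (A : Type*) [Mul A] : Prop := IsAtom (cloneOf A)

/-- The sequence of variables of a term, from left to right. -/
def leaves {α : Type*} : FreeMagma α → List α
  | FreeMagma.of a => [a]
  | FreeMagma.mul s t => leaves s ++ leaves t

/-- The bracketings of the product `x_0 ⋯ x_{n-1}`: the terms in which each of these variables
occurs exactly once, in this order. -/
def bracketings (n : ℕ) : Set (FreeMagma (Fin n)) := {t | leaves t = List.finRange n}

lemma finite_leaves {α : Type*} (k : ℕ) :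
    ∀ l : List α, l.length ≤ k → {t : FreeMagma α | leaves t = l}.Finite := by
  have hpos : ∀ t : FreeMagma α, 0 < (leaves t).length := by
    intro t
    induction t with
    | ih1 a => exact Nat.one_pos
    | ih2 s t hs _ =>
      change 0 < (leaves s ++ leaves t).length
      rw [List.length_append]
      omega
  induction k with
  | zero =>
    intro l hl
    refine Set.finite_empty.subset fun t ht => ?_
    have h1 := hpos t
    rw [show leaves t = l from ht] at h1
    omega
  | succ k ih =>
    intro l hl
    have hfin : ({t | ∃ a ∈ l, t = FreeMagma.of a} ∪
        ⋃ i ∈ Set.Ioo 0 l.length, Set.image2 (fun s t : FreeMagma α => s * t)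
          {t | leaves t = l.take i} {t | leaves t = l.drop i}).Finite := by
      refine Set.Finite.union ?_ ((Set.finite_Ioo 0 l.length).biUnion fun i hi => ?_)
      · refine ((List.finite_toSet l).image FreeMagma.of).subset ?_
        rintro t ⟨a, ha, rfl⟩
        exact ⟨a, ha, rfl⟩
      · have h1 := hi.1
        have h2 := hi.2
        refine Set.Finite.image2 _ (ih _ ?_) (ih _ ?_)
        · rw [List.length_take]
          omega
        · rw [List.length_drop]
          omega
    refine hfin.subset fun t ht => ?_
    cases t with
    | of a =>
      refine Or.inl ⟨a, ?_, rfl⟩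
      rw [← show leaves (FreeMagma.of a) = l from ht]
      exact List.mem_singleton.2 rfl
    | mul s t =>
      have hl' : leaves s ++ leaves t = l := ht
      subst hl'
      refine Or.inr (Set.mem_biUnion (x := (leaves s).length) ⟨hpos s, ?_⟩ ⟨s, ?_, t, ?_, rfl⟩)
      · rw [List.length_append]
        have := hpos t
        omega
      · simp
      · simp

/-- There are finitely many bracketings, so the cardinality below is a genuine one. -/
lemma finite_bracketings (n : ℕ) : (bracketings n).Finite :=
  finite_leaves _ (List.finRange n) le_rfl

/-- The associative spectrum: `spectrum A n` is the number of different term functions on `A`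
arising from the bracketings of `x_0 ⋯ x_{n-1}`. -/
noncomputable def spectrum (A : Type*) [Mul A] (n : ℕ) : ℕ :=
  (termFun A '' bracketings n).ncard

/-- The groupoid `A` is idempotent: `xx ≈ x`. -/
def IsIdempotent (A : Type*) [Mul A] : Prop := ∀ x : A, x * x = x

/-- The groupoid `A` is a semigroup. -/
def IsSemigroup (A : Type*) [Mul A] : Prop := ∀ x y z : A, (x * y) * z = x * (y * z)

/-- Membership in the variety `𝒜`, defined by `x(y(zu)) ≈ x((yz)u)`. -/
def InA (A : Type*) [Mul A] : Prop := ∀ x y z u : A, x * (y * (z * u)) = x * ((y * z) * u)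

/-- Membership in the variety `ℬ`, defined by
`xx ≈ x`, `x(xy) ≈ x(yx) ≈ (xy)x ≈ (xy)y ≈ (xy)(yx) ≈ xy`. -/
structure InB (A : Type*) [Mul A] : Prop where
  idem : ∀ x : A, x * x = x
  left_left : ∀ x y : A, x * (x * y) = x * y
  left_right : ∀ x y : A, x * (y * x) = x * y
  right_left : ∀ x y : A, (x * y) * x = x * y
  right_right : ∀ x y : A, (x * y) * y = x * y
  both : ∀ x y : A, (x * y) * (y * x) = x * y

/-- Membership in the variety `𝒞_p` of `p`-cyclic groupoids, defined by
`xx ≈ x`, `x(yz) ≈ xy`, `(xy)z ≈ (xz)y`, `(⋯((xy)y)⋯)y ≈ x` with `p` factors `y`. -/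
structure InC (p : ℕ) (A : Type*) [Mul A] : Prop where
  idem : ∀ x : A, x * x = x
  left : ∀ x y z : A, x * (y * z) = x * y
  right : ∀ x y z : A, (x * y) * z = (x * z) * y
  cyclic : ∀ x y : A, (fun w => w * y)^[p] x = x

/-- Membership in the variety `𝒟`, defined by `x(yx) ≈ (xy)x ≈ (xy)y ≈ (xy)(yx) ≈ xy` and
`x · ((⋯(x y₁)⋯) yₙ) ≈ x` for all `n ≥ 0` (for `n = 0` this is `xx ≈ x`). -/
structure InD (A : Type*) [Mul A] : Prop where
  left_right : ∀ x y : A, x * (y * x) = x * y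
  right_left : ∀ x y : A, (x * y) * x = x * y
  right_right : ∀ x y : A, (x * y) * y = x * y
  both : ∀ x y : A, (x * y) * (y * x) = x * y
  absorb : ∀ (x : A) (ys : List A), x * ys.foldl (fun w y => w * y) x = x

/-- `A` belongs to one of the varieties `ℬ ∩ 𝒜`, `𝒞_p` (`p` a prime), `𝒟 ∩ 𝒜`. -/
def InOneOf (A : Type*) [Mul A] : Prop :=
  (InB A ∧ InA A) ∨ (∃ p : ℕ, p.Prime ∧ InC p A) ∨ (InD A ∧ InA A)

end MinClone

namespace MinClone

section CloneTools

variable {A : Type*}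

/-- The opposite multiplication on the same type. -/
abbrev flipMul (A : Type*) [Mul A] : Mul A := ⟨fun x y => y * x⟩

lemma Clone.mul_mem [Mul A] {C : Clone A} (h : (fun v : Fin 2 → A => v 0 * v 1) ∈ C.ops 2)
    {n : ℕ} {f g : (Fin n → A) → A} (hf : f ∈ C.ops n) (hg : g ∈ C.ops n) :
    (fun v => f v * g v) ∈ C.ops n := by
  have := C.comp_mem (g := ![f, g]) (C.pos hf) h (by
    intro i
    fin_cases i
    · exact hf
    · exact hg)
  exact this

lemma mul_mem_cloneOf (A : Type*) [Mul A] :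
    (fun v : Fin 2 → A => v 0 * v 1) ∈ (cloneOf A).ops 2 :=
  ⟨FreeMagma.of 0 * FreeMagma.of 1, rfl⟩

lemma cloneOf_le [Mul A] {C : Clone A} (h : (fun v : Fin 2 → A => v 0 * v 1) ∈ C.ops 2) :
    cloneOf A ≤ C := by
  rintro n f ⟨t, rfl⟩
  induction t with
  | ih1 i => exact C.proj_mem i
  | ih2 s t hs ht => exact Clone.mul_mem h hs ht

lemma binary_minor_mem {C : Clone A} {n : ℕ} {f : (Fin n → A) → A} (hf : f ∈ C.ops n)
    (σ : Fin n → Fin 2) : (fun v : Fin 2 → A => f (fun i => v (σ i))) ∈ C.ops 2 :=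
  C.comp_mem (g := fun i v => v (σ i)) two_pos hf fun i => C.proj_mem (σ i)

lemma cloneOf_ne_bot [Mul A] (h : ¬ IsSemigroup A) : cloneOf A ≠ ⊥ := by
  intro hb
  have hm := mul_mem_cloneOf A
  rw [hb] at hm
  obtain ⟨i, hi⟩ := hm
  have key : ∀ x y : A, x * y = ![x, y] i := fun x y => (congrFun hi ![x, y]).symm
  apply h
  intro x y z
  fin_cases i <;> simp [key]

/-- A groupoid which is not a semigroup has a minimal clone as soon as every nontrivial term
function generates the multiplication. -/
lemma hasMinimalClone_of_generates [Mul A] (h : ¬ IsSemigroup A)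
    (H : ∀ {n : ℕ} (t : FreeMagma (Fin n)), (∃ i, ∀ v, termFun A t v = v i) ∨
      ∀ C : Clone A, termFun A t ∈ C.ops n → (fun v : Fin 2 → A => v 0 * v 1) ∈ C.ops 2) :
    HasMinimalClone A := by
  refine ⟨cloneOf_ne_bot h, fun C hC => ?_⟩
  by_contra hne
  have : ∃ n, ∃ f ∈ C.ops n, f ∉ (⊥ : Clone A).ops n := by
    by_contra hcon
    push Not at hcon
    exact hne (le_bot_iff.1 fun n f hf => hcon n f hf)
  obtain ⟨n, f, hf, hfb⟩ := this
  obtain ⟨t, rfl⟩ := hC.le n hf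
  rcases H t with ⟨i, hi⟩ | hgen
  · exact hfb ⟨i, funext fun v => (hi v).symm⟩
  · exact hC.not_ge (cloneOf_le (hgen C hf))

lemma HasMinimalClone.eq_of_le [Mul A] (h : HasMinimalClone A) {C : Clone A}
    (hC : C ≤ cloneOf A) (hb : C ≠ ⊥) : C = cloneOf A :=
  (h.le_iff.1 hC).resolve_left hb

lemma cloneOf_eq_of_not_proj [Mul A] (h : HasMinimalClone A) {t : A → A → A}
    (ht : (fun v : Fin 2 → A => t (v 0) (v 1)) ∈ (cloneOf A).ops 2)
    (h1 : ¬ ∀ x y, t x y = x) (h2 : ¬ ∀ x y, t x y = y) :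
    @cloneOf A ⟨t⟩ = cloneOf A := by
  refine h.eq_of_le (@cloneOf_le A ⟨t⟩ _ ht) fun hb => ?_
  have hm := @mul_mem_cloneOf A ⟨t⟩
  rw [hb] at hm
  obtain ⟨i, hi⟩ := hm
  have key : ∀ x y : A, t x y = ![x, y] i := fun x y => (congrFun hi ![x, y]).symm
  fin_cases i
  · exact h1 key
  · exact h2 key

lemma HasMinimalClone.not_fst [Mul A] (h : HasMinimalClone A) : ¬ ∀ x y : A, x * y = x := by
  intro hx
  apply h.1
  exact le_bot_iff.1 (cloneOf_le ⟨0, funext fun v => (hx _ _).symm⟩)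

lemma HasMinimalClone.not_snd [Mul A] (h : HasMinimalClone A) : ¬ ∀ x y : A, x * y = y := by
  intro hx
  apply h.1
  exact le_bot_iff.1 (cloneOf_le ⟨1, funext fun v => (hx _ _).symm⟩)

/-- Induction over the binary term operations of `(A, t)`. -/
lemma binary_induction [Mul A] {t : A → A → A} (h : @cloneOf A ⟨t⟩ = cloneOf A)
    (S : (A → A → A) → Prop) (fst : S fun x _ => x) (snd : S fun _ y => y)
    (comp : ∀ f g, S f → S g → S fun x y => t (f x y) (g x y)) : S fun x y => x * y := by
  have hm := mul_mem_cloneOf A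
  rw [← h] at hm
  obtain ⟨s, hs⟩ := hm
  have key : ∀ s : FreeMagma (Fin 2), S fun x y => @termFun A ⟨t⟩ 2 s ![x, y] := by
    intro s
    induction s with
    | ih1 i =>
      fin_cases i
      · exact fst
      · exact snd
    | ih2 a b ha hb => exact comp _ _ ha hb
  have := key s
  rw [hs] at this
  exact this

/-- The members of a clone all of whose binary minors are projections. -/
def binaryTrivial (C : Clone A) : Clone A where
  ops n := {f ∈ C.ops n | ∀ σ : Fin n → Fin 2, ∃ i : Fin 2, ∀ v : Fin 2 → A,
    f (fun j => v (σ j)) = v i}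
  pos hf := C.pos hf.1
  proj_mem i := ⟨C.proj_mem i, fun σ => ⟨σ i, fun _ => rfl⟩⟩
  comp_mem := by
    rintro m n f g hn ⟨hf, hf'⟩ hg
    refine ⟨C.comp_mem hn hf fun i => (hg i).1, fun σ => ?_⟩
    choose τ hτ using fun i => (hg i).2 σ
    obtain ⟨i, hi⟩ := hf' τ
    refine ⟨i, fun v => ?_⟩
    simp only [hτ]
    exact hi v

/-- In a minimal clone containing a nontrivial binary operation, an operation is a projection
as soon as its binary minors are. -/
lemma HasMinimalClone.proj_of_minors [Mul A] (h : HasMinimalClone A) {n : ℕ}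
    {f : (Fin n → A) → A} (hf : f ∈ (cloneOf A).ops n)
    (hm : ∀ σ : Fin n → Fin 2, ∃ i : Fin 2, ∀ v : Fin 2 → A, f (fun j => v (σ j)) = v i) :
    ∃ i, ∀ v, f v = v i := by
  have hle : binaryTrivial (cloneOf A) ≤ cloneOf A := fun n f hf => hf.1
  have hb : binaryTrivial (cloneOf A) = ⊥ := by
    by_contra hne
    have hmul := mul_mem_cloneOf A
    rw [← h.eq_of_le hle hne] at hmul
    obtain ⟨i, hi⟩ := hmul.2 id
    have key : ∀ x y : A, x * y = ![x, y] i := fun x y => hi ![x, y]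
    fin_cases i
    · exact h.not_fst key
    · exact h.not_snd key
  have hf' : f ∈ (binaryTrivial (cloneOf A)).ops n := ⟨hf, hm⟩
  rw [hb] at hf'
  obtain ⟨i, hi⟩ := hf'
  exact ⟨i, fun v => (congrFun hi v).symm⟩

/-- A ternary term operation of a minimal clone that is a first semiprojection is the first
projection. -/
lemma HasMinimalClone.semiproj [Mul A] (h : HasMinimalClone A) {s : A → A → A → A}
    (hs : (fun v : Fin 3 → A => s (v 0) (v 1) (v 2)) ∈ (cloneOf A).ops 3)
    (h01 : ∀ x z, s x x z = x) (h02 : ∀ x y, s x y x = x) (h12 : ∀ x y, s x y y = x)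
    (x y z : A) : s x y z = x := by
  obtain ⟨i, hi⟩ := h.proj_of_minors hs (fun σ => ⟨σ 0, fun v => by
    have : σ 0 = σ 1 ∨ σ 0 = σ 2 ∨ σ 1 = σ 2 := by
      generalize σ 0 = a, σ 1 = b, σ 2 = c
      decide +revert
    rcases this with e | e | e
    · simp [e, h01]
    · simp [e, h02]
    · simp [e, h12]⟩)
  have key : ∀ x y z, s x y z = ![x, y, z] i := fun x y z => hi ![x, y, z]
  fin_cases i
  · exact key x y z
  · have h3 : s x y x = y := key x y x
    have h4 : s x y z = y := key x y z
    rw [h4, ← h3, h02]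
  · have h3 : s x x z = z := key x x z
    have h4 : s x y z = z := key x y z
    rw [h4, ← h3, h01]

lemma cloneOf_flipMul (A : Type*) [Mul A] : @cloneOf A (flipMul A) = cloneOf A := by
  apply le_antisymm
  · exact @cloneOf_le A (flipMul A) _ ⟨FreeMagma.of 1 * FreeMagma.of 0, rfl⟩
  · refine cloneOf_le ?_
    exact ⟨FreeMagma.of 1 * FreeMagma.of 0, rfl⟩

end CloneTools

section Equational
variable {A : Type*} [Mul A]

lemma semigroup_of_mul_mul_mul_eq_pair (idem : ∀ x : A, x * x = x)
    (h : ∀ x y z u : A, x * ((y * z) * u) = (x * y) * (z * u)) : IsSemigroup A := by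
  have h1 : ∀ x y u : A, x * ((y * u) * u) = (x * y) * u := fun x y u => by
    rw [h, idem]
  have h2 : ∀ x y : A, (x * y) * y = x * y := fun x y => by
    rw [← h1, idem, idem]
  intro x y z
  rw [← h1, h2]

lemma semigroup_of_right_eq_left (idem : ∀ x : A, x * x = x)
    (h : ∀ x y z u : A, x * (y * (z * u)) = ((x * y) * z) * u) : IsSemigroup A := by
  have h1 : ∀ x y z : A, x * (x * (y * z)) = (x * y) * z := fun x y z => by rw [h, idem]
  have h2 : ∀ x y z : A, ((x * y) * z) * z = x * (y * z) := fun x y z => by rw [← h, idem]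
  have h3 : ∀ x y : A, x * (x * (x * y)) = x * y := fun x y => by rw [h, idem, idem]
  have h3' : ∀ x y : A, ((y * x) * x) * x = y * x := fun x y => by rw [← h, idem, idem]
  have h4 : ∀ x y z : A, (x * (y * z)) * z = (x * y) * z := fun x y z => by
    rw [← h2, h3']
  have h5 : ∀ x y z : A, x * ((x * y) * z) = x * (y * z) := fun x y z => by
    rw [← h1, h3]
  have h6 : ∀ x y z : A, x * ((y * z) * z) = x * (y * z) := fun x y z => by
    rw [← h3, h1 x (y * z) z, h4, h5]
  have h8 : ∀ x y : A, (x * y) * y = x * (x * y) := fun x y => by rw [← h2, idem]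
  have h7 : ∀ x y : A, x * (x * y) = x * y := fun x y => by
    have := h6 x x y
    rw [h8, h3] at this
    exact this.symm
  intro x y z
  rw [← h1, h7]

/-- The binary words over a band `(A, t)`, up to equality in the free band. -/
def IsBandWord {A : Type*} (t f : A → A → A) : Prop :=
  f = (fun x _ => x) ∨ f = (fun _ y => y) ∨ f = (fun x y => t x y) ∨ f = (fun x y => t y x) ∨
    f = (fun x y => t x (t y x)) ∨ f = (fun x y => t y (t x y))

lemma IsBandWord.comp {A : Type*} {t f g : A → A → A}
    (assoc : ∀ x y z, t (t x y) z = t x (t y z)) (idem : ∀ x, t x x = x)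
    (hf : IsBandWord t f) (hg : IsBandWord t g) : IsBandWord t fun x y => t (f x y) (g x y) := by
  have i1 : ∀ x y, t x (t x y) = t x y := fun x y => by rw [← assoc, idem]
  have i2 : ∀ x y, t x (t y (t x y)) = t x y := fun x y => by rw [← assoc, idem]
  rcases hf with rfl | rfl | rfl | rfl | rfl | rfl <;>
    rcases hg with rfl | rfl | rfl | rfl | rfl | rfl <;>
    simp only [IsBandWord, assoc, idem, i1, i2, true_or, or_true]

lemma IsBandWord.left_idem {A : Type*} {t f : A → A → A}
    (assoc : ∀ x y z, t (t x y) z = t x (t y z)) (idem : ∀ x, t x x = x)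
    (hf : IsBandWord t f) (x y : A) : f x (f x y) = f x y := by
  have i1 : ∀ x y, t x (t x y) = t x y := fun x y => by rw [← assoc, idem]
  have i2 : ∀ x y, t x (t y (t x y)) = t x y := fun x y => by rw [← assoc, idem]
  rcases hf with rfl | rfl | rfl | rfl | rfl | rfl <;> simp only [assoc, idem, i1, i2]

/-- The operation `x(xy)` turns out to be associative, and coincides with `xy`. -/
lemma semigroup_of_right_eq_inner (hmin : HasMinimalClone A) (idem : ∀ x : A, x * x = x)
    (h : ∀ x y z u : A, x * (y * (z * u)) = (x * (y * z)) * u) : IsSemigroup A := by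
  have cube : ∀ x u : A, x * (x * (x * u)) = x * u := fun x u => by rw [h, idem, idem]
  have h1 : ∀ x y u : A, (x * y) * u = x * (y * (y * u)) := fun x y u => by rw [h, idem]
  have sq : ∀ y z w : A, (y * z) * ((y * z) * w) = y * (z * w) := by
    intro y z w
    have key : ∀ x, x * (y * (z * w)) = x * ((y * z) * ((y * z) * w)) := fun x => by
      rw [h x y z w, h1 x (y * z) w]
    calc (y * z) * ((y * z) * w) = y * (y * ((y * z) * ((y * z) * w))) := by
          rw [h1 y z ((y * z) * w), cube]
      _ = y * (z * w) := by rw [← key, cube]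
  have assoc : ∀ x y z : A, (x * (x * y)) * ((x * (x * y)) * z) = x * (x * (y * (y * z))) := by
    intro x y z
    rw [sq, h1 x y z]
  have nfst : ¬ ∀ x y : A, x * (x * y) = x := fun hp => hmin.not_fst fun x y => by
    rw [← cube, hp]
  have nsnd : ¬ ∀ x y : A, x * (x * y) = y := fun hp => hmin.not_snd fun x y => by
    have e1 : ∀ y z u : A, y * (z * u) = u := fun y z u => by
      rw [← sq, hp]
    have := e1 x y y
    rwa [idem] at this
  have hc := cloneOf_eq_of_not_proj hmin (t := fun x y => x * (x * y))
    ⟨.of 0 * (.of 0 * .of 1), rfl⟩ nfst nsnd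
  have hxy : ∀ x y : A, x * (x * y) = x * y := by
    have := binary_induction hc (IsBandWord fun x y => x * (x * y)) (by simp [IsBandWord])
      (by simp [IsBandWord]) fun f g => IsBandWord.comp assoc fun x => by simp only [idem]
    exact fun x y => this.left_idem assoc (fun x => by simp only [idem]) x y
  intro x y z
  have := assoc x y z
  simpa only [hxy] using this

end Equational
section VarietyA
variable {A : Type*} [Mul A]

/-- Groupoids with a minimal clone that satisfy `x(yz) ≈ xz` are rectangular bands. -/
lemma mul_mul_eq_of_rectangular (hmin : HasMinimalClone A) (h : ∀ x y z : A, x * (y * z) = x * z)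
    (hx : ∀ x y : A, (x * y) * x = x) (idem : ∀ x : A, x * x = x) (x y z : A) :
    (x * y) * z = x * z := by
  have s : ∀ x y z : A, ((x * y) * z) * x = x := hmin.semiproj (s := fun x y z => ((x * y) * z) * x)
    ⟨((.of 0 * .of 1) * .of 2) * .of 0, rfl⟩ (fun x z => by simp only [idem, hx])
    (fun x y => by simp only [hx, idem]) (fun x y => by
      have e : (x * y) * y = x * y := by
        have := h (x * y) x y
        rw [← this, idem]
      simp only [e, hx])
  have e1 : (x * z) * ((x * y) * z) = (x * y) * z := by
    have := s ((x * y) * z) x z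
    rwa [s x y z] at this
  rw [← e1, h]
  have := h (x * z) x z
  rw [← this, idem]

lemma rectangular_of_left (hmin : HasMinimalClone A) (h : ∀ x y z : A, x * (y * z) = x * z)
    (idem : ∀ x : A, x * x = x) (x y : A) : (x * y) * x = x := by
  by_contra hne
  have yy : ∀ x y : A, (x * y) * y = x * y := fun x y => by
    have := h (x * y) x y
    rw [← this, idem]
  have nsnd : ¬ ∀ x y : A, (x * y) * x = y := fun hp => hmin.not_snd fun x y => by
    have := hp x (x * y)
    rw [h x x y, hp] at this
    exact this.symm
  have hc := cloneOf_eq_of_not_proj hmin (t := fun x y => (x * y) * x)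
    ⟨(.of 0 * .of 1) * .of 0, rfl⟩ (fun hp => hne (hp x y)) nsnd
  have := binary_induction hc (fun f =>
      (∀ x y, f x y * x = f x y) ∨ (∀ x y, f (x * y) y = y)) (Or.inl fun x _ => idem x)
      (Or.inr fun _ _ => rfl) ?_
  · rcases this with h1 | h1 <;> beta_reduce at h1
    · exact hmin.not_fst fun x y => by
        rw [← h x x y, ← h1 x y, h x (x * y) x, idem]
    · exact hmin.not_snd fun x y => by rw [← yy, h1]
  · rintro f g (hf | hf) hg
    · exact Or.inl fun x y => by
        have e := h (f x y * g x y) (f x y) x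
        rw [hf] at e
        beta_reduce
        rw [e, yy]
    · refine Or.inr fun x y => ?_
      have e : y * g (x * y) y = y := by
        rcases hg with hg | hg
        · rw [← hg, h, h, idem]
        · rw [hg, idem]
      simp only [hf, e, idem]

/-- The iterated right multiplication `(⋯((xy)y)⋯)y` with `k` factors `y`. -/
def rpow (k : ℕ) (x y : A) : A := (fun w => w * y)^[k] x

lemma rpow_one (x y : A) : rpow 1 x y = x * y := rfl

lemma rpow_succ (k : ℕ) (x y : A) : rpow (k + 1) x y = rpow k x y * y :=
  Function.iterate_succ_apply' _ _ _

lemma rpow_add (k l : ℕ) (x y : A) : rpow (k + l) x y = rpow k (rpow l x y) y :=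
  Function.iterate_add_apply _ _ _ _

lemma rpow_mul (k m : ℕ) (x y : A) : rpow (k * m) x y = (fun w => rpow k w y)^[m] x :=
  congrFun (Function.iterate_mul _ _ _) _

lemma rpow_mem {C : Clone A} (hC : (fun v : Fin 2 → A => v 0 * v 1) ∈ C.ops 2) (k : ℕ) {n : ℕ}
    {f g : (Fin n → A) → A} (hf : f ∈ C.ops n) (hg : g ∈ C.ops n) :
    (fun v => rpow k (f v) (g v)) ∈ C.ops n := by
  induction k with
  | zero => exact hf
  | succ k ih =>
    simp only [rpow_succ]
    exact Clone.mul_mem hC ih hg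

section LeftAbsorption

variable (idem : ∀ x : A, x * x = x) (h : ∀ x y z : A, x * (y * z) = x * y)

include h in
lemma mul_rpow (w x y : A) (k : ℕ) : w * rpow k x y = w * x := by
  induction k with
  | zero => rfl
  | succ k ih => rw [rpow_succ, h, ih]

lemma rpow_congr (k : ℕ) (x : A) {y y' : A} (hy : ∀ w, w * y = w * y') :
    rpow k x y = rpow k x y' := by
  simp only [rpow, hy]

include idem h in
lemma rpow_mul_self (x y : A) (k : ℕ) : rpow k x y * x = rpow k x y := by
  have := mul_rpow h (rpow k x y) x y k
  rw [← this, idem]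

include h in
lemma rpow_eq_self_or (hmin : HasMinimalClone A) (idem : ∀ x : A, x * x = x) (k : ℕ) :
    (∀ x y : A, rpow k x y = x) ∨ ∃ m, ∀ x y : A, rpow (k * m) x y = x * y := by
  by_contra! hcon
  obtain ⟨h1, h2⟩ := hcon
  have nsnd : ¬ ∀ x y : A, rpow k x y = y := fun hp => hmin.not_fst fun y x => by
    rw [← hp x (y * x), rpow_congr k x fun w => h w y x, hp]
  have hc := cloneOf_eq_of_not_proj hmin (t := rpow k)
    (rpow_mem (mul_mem_cloneOf A) k ((cloneOf A).proj_mem 0) ((cloneOf A).proj_mem 1))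
    (fun hp => by obtain ⟨x, y, hxy⟩ := h1; exact hxy (hp x y)) nsnd
  have := binary_induction hc (fun f =>
      (∃ m, ∀ x y, f x y = rpow (k * m) x y) ∨ (∃ m, ∀ x y, f x y = rpow (k * m) y x))
      (Or.inl ⟨0, fun x _ => rfl⟩) (Or.inr ⟨0, fun _ _ => rfl⟩) ?_
  · rcases this with ⟨m, hm⟩ | ⟨m, hm⟩
    · obtain ⟨x, y, hxy⟩ := h2 m
      exact hxy (hm x y).symm
    · refine hmin.not_fst fun x y => ?_
      beta_reduce at hm
      rw [← mul_rpow h x y x (k * m), ← hm, h, idem]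
  · have key : ∀ (x y : A) (m m' : ℕ), rpow k (rpow (k * m) x y) (rpow (k * m') x y) =
        rpow (k * m) x y := by
      intro x y m m'
      rw [rpow_congr k _ fun w => mul_rpow h w x y _]
      exact Function.iterate_fixed (rpow_mul_self idem h x y _) k
    have key' : ∀ (x y : A) (m m' : ℕ), rpow k (rpow (k * m) x y) (rpow (k * m') y x) =
        rpow (k * (m + 1)) x y := by
      intro x y m m'
      rw [rpow_congr k _ fun w => mul_rpow h w y x _, ← rpow_add, mul_add, mul_one, add_comm]
    rintro f g (⟨m, hf⟩ | ⟨m, hf⟩) (⟨m', hg⟩ | ⟨m', hg⟩)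
    · exact Or.inl ⟨m, fun x y => by simp only [hf, hg, key]⟩
    · exact Or.inl ⟨m + 1, fun x y => by simp only [hf, hg, key']⟩
    · exact Or.inr ⟨m + 1, fun x y => by simp only [hf, hg, key']⟩
    · exact Or.inr ⟨m, fun x y => by simp only [hf, hg, key]⟩

include idem h in
lemma mul_comm_of_rpow (hmin : HasMinimalClone A) {p : ℕ} (hp : 0 < p)
    (hcyc : ∀ x y : A, rpow p x y = x) (x y z : A) : (x * y) * z = (x * z) * y := by
  obtain ⟨q, rfl⟩ := Nat.exists_eq_succ_of_ne_zero hp.ne'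
  have inv : ∀ x y : A, rpow q (x * y) y = x := hcyc
  have inv' : ∀ x y : A, rpow q x y * y = x := fun x y => by rw [← rpow_succ, hcyc]
  have fx : ∀ x y : A, x * y = x → rpow q x y = x := fun x y hxy =>
    Function.iterate_fixed hxy q
  have xyx : ∀ x y : A, (x * y) * x = x * y := fun x y => rpow_mul_self idem h x y 1
  have hC := mul_mem_cloneOf A
  have s := hmin.semiproj (s := fun x y z => rpow q (rpow q ((x * y) * z) y) z)
    (rpow_mem hC q (rpow_mem hC q ⟨(.of 0 * .of 1) * .of 2, rfl⟩ ((cloneOf A).proj_mem 1))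
      ((cloneOf A).proj_mem 2))
    (fun x z => by rw [idem, fx _ _ (xyx x z), inv])
    (fun x y => by rw [xyx, inv, fx _ _ (idem x)])
    (fun x y => by rw [inv, inv]) x y z
  rw [← inv' ((x * y) * z) y, ← inv' (rpow q _ y) z, s]

include idem h in
lemma inD_or_inC_of_left_absorption (hmin : HasMinimalClone A) :
    (InD A ∧ InA A) ∨ ∃ p : ℕ, p.Prime ∧ InC p A := by
  classical
  by_cases hex : ∃ n, 0 < n ∧ ∀ x y : A, rpow n x y = x
  · right
    refine ⟨Nat.find hex, ?_, ?_⟩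
    · have hn := Nat.find_spec hex
      have hm := fun k => Nat.find_min (m := k) hex
      generalize Nat.find hex = n at hn hm
      refine Nat.prime_def.2 ⟨?_, fun k hk => ?_⟩
      · by_contra hlt
        have : n = 1 := by omega
        subst this
        exact hmin.not_fst hn.2
      · obtain ⟨l, rfl⟩ := hk
        by_contra! hne
        have hk : 0 < k := Nat.pos_of_mul_pos_right hn.1
        have hl : 0 < l := Nat.pos_of_mul_pos_left hn.1
        rcases rpow_eq_self_or h hmin idem k with h1 | ⟨m, h1⟩
        · refine hm k ?_ ⟨hk, h1⟩
          have : l ≠ 1 := fun e => hne.2 (by rw [e, mul_one])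
          have : 2 ≤ l := by omega
          nlinarith
        · refine hm l ?_ ⟨hl, fun x y => ?_⟩
          · have : 2 ≤ k := by have := hne.1; omega
            nlinarith
          · have e : rpow (k * m * l) x y = rpow l x y := by
              rw [rpow_mul (k * m)]
              simp only [h1]
              rfl
            rw [← e, mul_right_comm, rpow_mul (k * l)]
            exact Function.iterate_fixed (hn.2 x y) m
    · obtain ⟨hn, hc⟩ := Nat.find_spec hex
      exact ⟨idem, h, mul_comm_of_rpow idem h hmin hn hc, hc⟩
  · left
    push Not at hex
    have npos : ∀ m, (∀ x y : A, rpow m x y = x * y) → 0 < m := fun m hm => by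
      rcases Nat.eq_zero_or_pos m with rfl | hpos
      · exact absurd (fun x y => (hm x y).symm) hmin.not_fst
      · exact hpos
    have get : ∀ k, 0 < k → ∃ m, 0 < m ∧ ∀ x y : A, rpow (k * m) x y = x * y := by
      intro k hk
      rcases rpow_eq_self_or h hmin idem k with h1 | ⟨m, h1⟩
      · obtain ⟨x, y, hxy⟩ := hex k hk
        exact absurd (h1 x y) hxy
      · exact ⟨m, Nat.pos_of_mul_pos_left (npos _ h1), h1⟩
    obtain ⟨m, hm, h2⟩ := get 2 two_pos
    obtain ⟨e, rfl⟩ := Nat.exists_eq_succ_of_ne_zero hm.ne'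
    have h3 : ∀ x y : A, rpow (2 * e + 1) (x * y) y = x * y := h2
    obtain ⟨m', hm', h4⟩ := get (2 * e + 1) (by omega)
    obtain ⟨d, rfl⟩ := Nat.exists_eq_succ_of_ne_zero hm'.ne'
    have yy : ∀ x y : A, (x * y) * y = x * y := by
      intro x y
      have e1 : x * y = rpow (2 * e + 1) x y := by
        rw [← h4, rpow_mul, Function.iterate_succ_apply]
        refine Function.iterate_fixed ?_ d
        rw [rpow_succ (2 * e) x y, h3]
      conv_lhs => rw [e1]
      rw [← rpow_succ]
      exact h2 x y
    have fold : ∀ (ys : List A) (w x : A), w * ys.foldl (fun w y => w * y) x = w * x := by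
      intro ys
      induction ys with
      | nil => intros; rfl
      | cons y ys ih => intro w x; rw [List.foldl_cons, ih, h]
    have xyx : ∀ x y : A, (x * y) * x = x * y := fun x y => rpow_mul_self idem h x y 1
    exact ⟨⟨fun x y => h x y x, xyx, yy, fun x y => by rw [h, yy],
      fun x ys => by rw [fold, idem]⟩, fun x y z u => by rw [h, h, h]⟩

end LeftAbsorption

lemma semigroup_of_inA_of_mul_mul_self (idem : ∀ x : A, x * x = x) (hA : InA A)
    (hx : ∀ x y : A, x * (y * x) = y * x) : IsSemigroup A := by
  intro x y z
  generalize ha : (x * y) * z = a, hb : x * (y * z) = b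
  have key : ∀ u, u * a = u * b := fun u => by rw [← ha, ← hb, hA]
  have e1 : a * b = a := by rw [← key, idem]
  have e2 : b * a = b := by rw [key, idem]
  have e3 := hx b a
  rw [e1, e2] at e3
  exact e3.symm

/-- In a groupoid of `ℬ` the only binary term operations are `x`, `y`, `xy` and `yx`. -/
lemma InB.eq_or_eq_flip (hmin : HasMinimalClone A) {t : A → A → A} (hB : @InB A ⟨t⟩)
    (hc : @cloneOf A ⟨t⟩ = cloneOf A) : (∀ x y, x * y = t x y) ∨ (∀ x y, x * y = t y x) := by
  have l1 : ∀ x, t x x = x := @InB.idem A ⟨t⟩ hB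
  have l2 : ∀ x y, t x (t x y) = t x y := @InB.left_left A ⟨t⟩ hB
  have l3 : ∀ x y, t x (t y x) = t x y := @InB.left_right A ⟨t⟩ hB
  have l4 : ∀ x y, t (t x y) x = t x y := @InB.right_left A ⟨t⟩ hB
  have l5 : ∀ x y, t (t x y) y = t x y := @InB.right_right A ⟨t⟩ hB
  have l6 : ∀ x y, t (t x y) (t y x) = t x y := @InB.both A ⟨t⟩ hB
  have := binary_induction hc (fun f => (f = fun x _ => x) ∨ (f = fun _ y => y) ∨
    (f = fun x y => t x y) ∨ (f = fun x y => t y x)) (by simp) (by simp) ?_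
  · rcases this with e | e | e | e
    · exact absurd (fun x y => congrFun₂ e x y) hmin.not_fst
    · exact absurd (fun x y => congrFun₂ e x y) hmin.not_snd
    · exact Or.inl fun x y => congrFun₂ e x y
    · exact Or.inr fun x y => congrFun₂ e x y
  · rintro f g (rfl | rfl | rfl | rfl) (rfl | rfl | rfl | rfl) <;>
      simp only [l1, l2, l3, l4, l5, l6, true_or, or_true]

/-- A groupoid whose clone is generated by a rectangular band is a semigroup. -/
lemma semigroup_of_cloneOf_eq_rectangular (hmin : HasMinimalClone A) {t : A → A → A}
    (idem : ∀ x, t x x = x) (h1 : ∀ x y z, t x (t y z) = t x z)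
    (h2 : ∀ x y z, t (t x y) z = t x z) (hc : @cloneOf A ⟨t⟩ = cloneOf A) : IsSemigroup A := by
  have := binary_induction hc (fun f => (f = fun x _ => x) ∨ (f = fun _ y => y) ∨
    (f = fun x y => t x y) ∨ (f = fun x y => t y x)) (by simp) (by simp) ?_
  · rcases this with e | e | e | e
    · exact absurd (fun x y => congrFun₂ e x y) hmin.not_fst
    · exact absurd (fun x y => congrFun₂ e x y) hmin.not_snd
    · have e : ∀ x y, x * y = t x y := fun x y => congrFun₂ e x y
      intro x y z
      simp only [e, h1, h2]
    · have e : ∀ x y, x * y = t y x := fun x y => congrFun₂ e x y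
      intro x y z
      simp only [e, h1, h2]
  · rintro f g (rfl | rfl | rfl | rfl) (rfl | rfl | rfl | rfl) <;>
      simp only [idem, h1, h2, true_or, or_true]

lemma inOneOf_of_inA (hmin : HasMinimalClone A) (idem : ∀ x : A, x * x = x) (hA : InA A) :
    IsSemigroup A ∨ InOneOf A := by
  have n1 : ∀ x y z u : A, x * ((y * z) * u) = x * (y * (z * u)) := fun x y z u => (hA x y z u).symm
  have n2 : ∀ x y z : A, x * (y * (y * z)) = x * (y * z) := fun x y z => by rw [hA, idem]
  have n4 : ∀ p x y : A, p * (x * (y * (x * y))) = p * (x * y) := fun p x y => by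
    rw [← n1 p x y, idem]
  by_cases c1 : ∀ x y : A, x * (x * y) = x
  · have h : ∀ x y z : A, x * (y * z) = x * y := fun x y z => by rw [← n2, c1]
    rcases inD_or_inC_of_left_absorption idem h hmin with hD | hC
    · exact Or.inr (Or.inr (Or.inr hD))
    · exact Or.inr (Or.inr (Or.inl hC))
  have ns1 : ¬ ∀ x y : A, x * (x * y) = y := fun hp => hmin.not_snd fun x y => by
    rw [← hp x (x * y), n2, hp]
  by_cases c2 : ∀ x y : A, x * (x * (y * x)) = x
  · left
    have hc := cloneOf_eq_of_not_proj hmin (t := fun x y => x * (x * y))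
      ⟨.of 0 * (.of 0 * .of 1), rfl⟩ c1 ns1
    have hmin' : @HasMinimalClone A ⟨fun x y => x * (x * y)⟩ := by
      unfold HasMinimalClone
      rw [hc]
      exact hmin
    have w : ∀ p x y : A, p * (x * (y * x)) = p * x := fun p x y => by rw [← n2, c2]
    have w' : ∀ x y z : A, x * (x * (y * z)) = x * (x * z) := fun x y z => by
      have e : x * ((x * (x * ((y * z) * x))) * z) = x * (x * z) := by rw [c2]
      simpa only [n1, n2, w] using e
    have r1 : ∀ x y z : A, x * (x * (y * (y * z))) = x * (x * z) := fun x y z => by rw [n2, w']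
    have i1 : ∀ x : A, x * (x * x) = x := fun x => by rw [idem, idem]
    have r2 := @rectangular_of_left A ⟨fun x y => x * (x * y)⟩ hmin' r1 i1
    have r3 := @mul_mul_eq_of_rectangular A ⟨fun x y => x * (x * y)⟩ hmin' r1 r2 i1
    exact semigroup_of_cloneOf_eq_rectangular hmin i1 r1 r3 hc
  · have ns2 : ¬ ∀ x y : A, x * (x * (y * x)) = y := fun hp => hmin.not_fst fun y x => by
      rw [← hp x (y * x), n1, idem, hp]
    have hc := cloneOf_eq_of_not_proj hmin (t := fun x y => x * (x * (y * x)))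
      ⟨.of 0 * (.of 0 * (.of 1 * .of 0)), rfl⟩ c2 ns2
    have key : ∀ x y w : A, (∀ q, q * (x * (y * (x * (w * (x * (y * x)))))) = q * (x * (y * x))) →
        (x * (x * (y * x))) * ((x * (x * (y * x))) * (w * (x * (x * (y * x))))) =
          x * (x * (y * x)) := fun x y w hw => by
      have e : ∀ q, q * ((x * (x * (y * x))) * (w * (x * (x * (y * x))))) =
          q * (x * (x * (y * x))) := fun q => by simpa only [n1, n2] using hw q
      rw [e, idem]
    have hB : @InB A ⟨fun x y => x * (x * (y * x))⟩ := by
      refine @InB.mk A ⟨_⟩ ?_ ?_ ?_ ?_ ?_ ?_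
      · intro x
        change x * (x * (x * x)) = x
        simp only [idem]
      · intro x y
        change x * (x * ((x * (x * (y * x))) * x)) = x * (x * (y * x))
        simp only [n1, n2, idem]
      · intro x y
        change x * (x * ((y * (y * (x * y))) * x)) = x * (x * (y * x))
        simp only [n1, n2, n4]
      · intro x y
        refine key x y x fun q => ?_
        simp only [n2, n4]
      · intro x y
        refine key x y y fun q => ?_
        simp only [n4]
      · intro x y
        refine key x y (y * (y * (x * y))) fun q => ?_
        simp only [n1, n2, n4]
    rcases hB.eq_or_eq_flip hmin hc with e | e
    · refine Or.inr (Or.inl ⟨?_, hA⟩)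
      have e : (fun x y : A => x * y) = fun x y => x * (x * (y * x)) := funext₂ e
      change @InB A ⟨fun x y => x * y⟩
      rw [e]
      exact hB
    · refine Or.inl (semigroup_of_inA_of_mul_mul_self idem hA fun x y => ?_)
      have e1 : ∀ q, q * ((y * x) * (x * (y * x))) = q * (y * x) := fun q => by
        simp only [n1, n2, n4]
      rw [e x (y * x), e1, idem]

end VarietyA
section Terms

/-- The leftmost variable of a term. -/
def leftmost {α : Type*} : FreeMagma α → α
  | FreeMagma.of a => a
  | FreeMagma.mul s _ => leftmost s

variable {α : Type*} {A : Type*} [Mul A]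

@[simp] lemma leftmost_of (a : α) : leftmost (FreeMagma.of a) = a := rfl

@[simp] lemma leftmost_mul (s t : FreeMagma α) : leftmost (s * t) = leftmost s := rfl

@[simp] lemma leaves_of (a : α) : leaves (FreeMagma.of a) = [a] := rfl

@[simp] lemma leaves_mul (s t : FreeMagma α) : leaves (s * t) = leaves s ++ leaves t := rfl

lemma leftmost_mem_leaves (t : FreeMagma α) : leftmost t ∈ leaves t := by
  induction t with
  | ih1 a => simp
  | ih2 s t hs _ => simp [hs]

lemma lift_congr {v w : α → A} {t : FreeMagma α} (h : ∀ a ∈ leaves t, v a = w a) :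
    FreeMagma.lift v t = FreeMagma.lift w t := by
  induction t with
  | ih1 a => exact h a (by simp)
  | ih2 s t hs ht =>
    rw [map_mul, map_mul, hs fun a ha => h a (by simp [ha]), ht fun a ha => h a (by simp [ha])]

lemma lift_eq_of_forall (idem : ∀ x : A, x * x = x) {v : α → A} {t : FreeMagma α} {c : A}
    (h : ∀ a ∈ leaves t, v a = c) : FreeMagma.lift v t = c := by
  induction t with
  | ih1 a => exact h a (by simp)
  | ih2 s t hs ht =>
    rw [map_mul, hs fun a ha => h a (by simp [ha]), ht fun a ha => h a (by simp [ha]), idem]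

lemma mul_mem_of_minor {n : ℕ} {t : FreeMagma (Fin n)} (p : Fin n → Prop) [DecidablePred p]
    (h : ∀ x y : A, FreeMagma.lift (fun a => if p a then x else y) t = x * y)
    {C : Clone A} (hC : termFun A t ∈ C.ops n) : (fun v : Fin 2 → A => v 0 * v 1) ∈ C.ops 2 := by
  have hm := binary_minor_mem hC fun a => if p a then 0 else 1
  convert hm using 1
  funext v
  rw [← h]
  unfold termFun
  congr 1
  congr 1
  funext a
  split_ifs <;> rfl

lemma InB.lift_ite (hB : InB A) (p : α → Prop) [DecidablePred p] (x y : A) (t : FreeMagma α) :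
    FreeMagma.lift (fun a => if p a then x else y) t =
      if p (leftmost t) then (if ∀ a ∈ leaves t, p a then x else x * y)
      else (if ∀ a ∈ leaves t, ¬ p a then y else y * x) := by
  induction t with
  | ih1 a => by_cases h : p a <;> simp [h]
  | ih2 s t hs ht =>
    have h1 := leftmost_mem_leaves s
    have h2 := leftmost_mem_leaves t
    have hs1 : (∀ a ∈ leaves (s * t), p a) ↔
      (∀ a ∈ leaves s, p a) ∧ ∀ a ∈ leaves t, p a := by simp [or_imp, forall_and]
    have hs2 : (∀ a ∈ leaves (s * t), ¬ p a) ↔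
      (∀ a ∈ leaves s, ¬ p a) ∧ ∀ a ∈ leaves t, ¬ p a := by simp [or_imp, forall_and]
    by_cases c1 : p (leftmost s) <;> by_cases c2 : p (leftmost t) <;>
    rcases Classical.propComplete (∀ a ∈ leaves s, p a) with c3 | c3 <;>
    rcases Classical.propComplete (∀ a ∈ leaves t, p a) with c4 | c4 <;>
    rcases Classical.propComplete (∀ a ∈ leaves s, ¬ p a) with c5 | c5 <;>
    rcases Classical.propComplete (∀ a ∈ leaves t, ¬ p a) with c6 | c6 <;>
    first
    | exact absurd (of_eq_true c3 _ h1) c1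
    | exact absurd (of_eq_true c4 _ h2) c2
    | exact absurd c1 (of_eq_true c5 _ h1)
    | exact absurd c2 (of_eq_true c6 _ h2)
    | simp only [map_mul, hs, ht, leftmost_mul, hs1, hs2, c1, c2, c3, c4, c5, c6, if_true, if_false,
        and_self, and_true, and_false, hB.idem, hB.left_left, hB.left_right, hB.right_left,
        hB.right_right, hB.both]

lemma InB.hasMinimalClone (hB : InB A) (hns : ¬ IsSemigroup A) : HasMinimalClone A := by
  refine hasMinimalClone_of_generates hns fun {n} t => ?_
  by_cases h : ∀ a ∈ leaves t, a = leftmost t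
  · exact Or.inl ⟨leftmost t, fun v => lift_eq_of_forall hB.idem fun a ha => by rw [h a ha]⟩
  · refine Or.inr fun C => mul_mem_of_minor (fun a => a = leftmost t) fun x y => ?_
    rw [hB.lift_ite, if_pos rfl, if_neg h]

lemma InD.idem (hD : InD A) (x : A) : x * x = x := hD.absorb x []

lemma InD.lift_ite (hD : InD A) (p : α → Prop) [DecidablePred p] (x y : A) (t : FreeMagma α) :
    if p (leftmost t) then FreeMagma.lift (fun a => if p a then x else y) t ∈ ({x, x * y} : Set A)
    else FreeMagma.lift (fun a => if p a then x else y) t ∈ ({y, y * x} : Set A) := by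
  have ll : ∀ x y : A, x * (x * y) = x := fun x y => hD.absorb x [y]
  induction t with
  | ih1 a => by_cases h : p a <;> simp [h]
  | ih2 s t hs ht =>
    simp only [map_mul, leftmost_mul]
    generalize FreeMagma.lift (fun a => if p a then x else y) s = e at *
    generalize FreeMagma.lift (fun a => if p a then x else y) t = f at *
    split_ifs at hs ht ⊢ <;> rcases hs with rfl | rfl <;> rcases ht with rfl | rfl <;>
      simp [hD.idem, hD.left_right, hD.right_left, hD.right_right, hD.both, ll]

lemma exists_lift_eq_foldl (v : α → A) (t : FreeMagma α) :
    ∃ ys : List A, FreeMagma.lift v t = ys.foldl (fun w y => w * y) (v (leftmost t)) := by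
  induction t with
  | ih1 a => exact ⟨[], rfl⟩
  | ih2 s t hs _ =>
    obtain ⟨ys, hys⟩ := hs
    exact ⟨ys ++ [FreeMagma.lift v t], by simp [hys]⟩

lemma InD.lift_eq_or (hD : InD A) [DecidableEq α] (t : FreeMagma α) :
    (∀ v : α → A, FreeMagma.lift v t = v (leftmost t)) ∨
    ∀ x y : A, FreeMagma.lift (fun a => if a = leftmost t then x else y) t = x * y := by
  induction t with
  | ih1 a => exact Or.inl fun v => rfl
  | ih2 s t hs _ =>
    have ht := fun x y => hD.lift_ite (fun a => a = leftmost s) x y t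
    rcases hs with hs | hs
    · by_cases c : leftmost t = leftmost s
      · refine Or.inl fun v => ?_
        obtain ⟨ys, hys⟩ := exists_lift_eq_foldl v t
        rw [map_mul, hs, hys, c, hD.absorb, leftmost_mul]
      · refine Or.inr fun x y => ?_
        have := ht x y
        rw [if_neg c] at this
        rw [map_mul, leftmost_mul, hs, if_pos rfl]
        rcases this with h | h <;> rw [h]
        rw [hD.left_right]
    · refine Or.inr fun x y => ?_
      have := ht x y
      rw [map_mul, leftmost_mul, hs]
      split_ifs at this <;>
      rcases this with h | h <;> rw [h] <;> simp [hD.idem, hD.right_left, hD.right_right, hD.both]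

lemma InD.hasMinimalClone (hD : InD A) (hns : ¬ IsSemigroup A) : HasMinimalClone A := by
  refine hasMinimalClone_of_generates hns fun {n} t => ?_
  rcases hD.lift_eq_or t with h | h
  · exact Or.inl ⟨leftmost t, h⟩
  · exact Or.inr fun C => mul_mem_of_minor (fun a => a = leftmost t) h

/-- The leftmost variables of the right factors along the left spine of a term. -/
def spineHeads : FreeMagma α → List α
  | FreeMagma.of _ => []
  | FreeMagma.mul s t => spineHeads s ++ [leftmost t]

lemma mul_lift_eq (h : ∀ x y z : A, x * (y * z) = x * y) (w : A) (v : α → A) (t : FreeMagma α) :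
    w * FreeMagma.lift v t = w * v (leftmost t) := by
  induction t with
  | ih1 a => rfl
  | ih2 s t hs _ => rw [map_mul, h, hs, leftmost_mul]

lemma lift_eq_foldl_spineHeads (h : ∀ x y z : A, x * (y * z) = x * y) (v : α → A)
    (t : FreeMagma α) :
    FreeMagma.lift v t = (spineHeads t).foldl (fun w a => w * v a) (v (leftmost t)) := by
  induction t with
  | ih1 a => rfl
  | ih2 s t hs _ =>
    change _ = (spineHeads s ++ [leftmost t]).foldl _ _
    rw [map_mul, mul_lift_eq h, hs, List.foldl_append]
    rfl

lemma foldl_replicate_eq (v : α → A) (k : ℕ) (j : α) (x : A) :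
    (List.replicate k j).foldl (fun w a => w * v a) x = rpow k x (v j) := by
  induction k generalizing x with
  | zero => rfl
  | succ k ih => exact ih _

lemma InC.foldl_eq_self {p : ℕ} (hC : InC p A) (hp : 0 < p) [DecidableEq α] (i : α) (v : α → A) :
    ∀ (k : ℕ) (l : List α), l.length ≤ k → (∀ j, j ≠ i → p ∣ l.count j) →
      l.foldl (fun w a => w * v a) (v i) = v i := by
  have : RightCommutative fun (w : A) (a : α) => w * v a := ⟨fun w a b => hC.right w _ _⟩
  intro k
  induction k with
  | zero =>
    intro l hl _
    rw [List.length_eq_zero_iff.1 (Nat.le_zero.1 hl)]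
    rfl
  | succ k ih =>
    intro l hl hd
    cases l with
    | nil => rfl
    | cons j l =>
      by_cases hj : j = i
      · subst hj
        rw [List.foldl_cons, hC.idem]
        refine ih l (by simpa using hl) fun a ha => ?_
        have := hd a ha
        rwa [List.count_cons_of_ne ha.symm] at this
      · have hle : p ≤ (j :: l).count j := Nat.le_of_dvd (by simp) (hd j hj)
        obtain ⟨l', hl'⟩ := (List.replicate_sublist_iff.2 hle).exists_perm_append
        rw [hl'.foldl_eq, List.foldl_append]
        have e : (List.replicate p j).foldl (fun w a => w * v a) (v i) = v i := by
          rw [foldl_replicate_eq]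
          exact hC.cyclic (v i) (v j)
        rw [e]
        refine ih l' ?_ fun a ha => ?_
        · have := hl'.length_eq
          simp only [List.length_append, List.length_replicate] at this
          omega
        · have := hd a ha
          rw [hl'.count_eq, List.count_append] at this
          refine (Nat.dvd_add_right ?_).1 this
          rw [List.count_replicate]
          split_ifs <;> simp

lemma InC.foldl_ite {p : ℕ} (hC : InC p A) [DecidableEq α] {j : α} (x y : A)
    (l : List α) : l.foldl (fun w a => w * (if a ≠ j then x else y)) x = rpow (l.count j) x y := by
  induction l using List.reverseRecOn with
  | nil => rfl
  | append_singleton l a ih =>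
    rw [List.foldl_append, ih, List.count_append]
    by_cases h : a = j
    · subst h
      simp [rpow_succ]
    · simp [h, rpow_mul_self hC.idem hC.left]

lemma InC.hasMinimalClone {p : ℕ} (hp : p.Prime) (hC : InC p A) (hns : ¬ IsSemigroup A) :
    HasMinimalClone A := by
  refine hasMinimalClone_of_generates hns fun {n} t => ?_
  by_cases h : ∀ j, j ≠ leftmost t → p ∣ (spineHeads t).count j
  · exact Or.inl ⟨leftmost t, fun v => (lift_eq_foldl_spineHeads hC.left v t).trans
      (hC.foldl_eq_self hp.pos _ v _ _ le_rfl h)⟩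
  · right
    push Not at h
    obtain ⟨j, hj, hd⟩ := h
    intro C hmem
    have h1 := binary_minor_mem hmem fun a => if a ≠ j then 0 else 1
    have e1 : ∀ x y : A, FreeMagma.lift (fun a => if a ≠ j then x else y) t =
        rpow ((spineHeads t).count j) x y := fun x y => by
      rw [lift_eq_foldl_spineHeads hC.left, if_pos hj.symm, hC.foldl_ite]
    generalize (spineHeads t).count j = k at *
    have e2 : (fun v : Fin 2 → A => termFun A t fun i => v (if i ≠ j then 0 else 1)) =
        fun v => rpow k (v 0) (v 1) := by
      funext v
      rw [← e1]
      unfold termFun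
      congr 2
      funext a
      split_ifs <;> rfl
    rw [e2] at h1
    have h2 : ∀ m, (fun v : Fin 2 → A => rpow (k * m) (v 0) (v 1)) ∈ C.ops 2 := by
      intro m
      induction m with
      | zero => exact C.proj_mem 0
      | succ m ih =>
        have := C.comp_mem (g := ![fun v => rpow (k * m) (v 0) (v 1), fun v => v 1]) two_pos h1
          (by
            intro i
            fin_cases i
            · exact ih
            · exact C.proj_mem 1)
        simp only [mul_add, mul_one, add_comm _ k, rpow_add]
        exact this
    obtain ⟨m, hm⟩ := Nat.exists_mul_mod_eq_one_of_coprime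
      ((Nat.Prime.coprime_iff_not_dvd hp).2 hd).symm hp.one_lt
    have h3 := h2 m
    have e3 : ∀ x y : A, rpow (k * m) x y = x * y := fun x y => by
      rw [← Nat.div_add_mod (k * m) p, hm.2, add_comm, rpow_add, rpow_mul, rpow_one]
      congr 1
      exact Function.iterate_fixed (hC.cyclic x y) _
    simpa only [e3] using h3

lemma InOneOf.hasMinimalClone (h : InOneOf A) (hns : ¬ IsSemigroup A) : HasMinimalClone A := by
  rcases h with h | ⟨p, hp, h⟩ | h
  · exact h.1.hasMinimalClone hns
  · exact h.hasMinimalClone hp hns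
  · exact h.1.hasMinimalClone hns

end Terms
section Spectrum

variable {α : Type*} {A : Type*} [Mul A]

/-- The lengths of the right factors along the left spine of a term, the outermost one first. -/
def blocks : FreeMagma α → List ℕ
  | FreeMagma.of _ => []
  | FreeMagma.mul s t => (leaves t).length :: blocks s

@[simp] lemma blocks_of (a : α) : blocks (FreeMagma.of a) = [] := rfl

@[simp] lemma blocks_mul (s t : FreeMagma α) :
    blocks (s * t) = (leaves t).length :: blocks s := rfl

lemma leaves_ne_nil (t : FreeMagma α) : leaves t ≠ [] :=
  List.ne_nil_of_mem (leftmost_mem_leaves t)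

lemma head?_leaves (t : FreeMagma α) : (leaves t).head? = some (leftmost t) := by
  induction t with
  | ih1 a => rfl
  | ih2 s t hs _ => rw [leaves_mul, List.head?_append, hs]; rfl

lemma length_leaves_pos (t : FreeMagma α) : 0 < (leaves t).length :=
  List.length_pos_of_ne_nil (leaves_ne_nil t)

lemma sum_blocks (t : FreeMagma α) : (blocks t).sum + 1 = (leaves t).length := by
  induction t with
  | ih1 a => rfl
  | ih2 s t hs _ => simp only [blocks_mul, leaves_mul, List.sum_cons, List.length_append]; omega

lemma blocks_pos (t : FreeMagma α) : ∀ k ∈ blocks t, 0 < k := by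
  induction t with
  | ih1 a => simp
  | ih2 s t hs _ =>
    intro k hk
    rcases List.mem_cons.1 hk with rfl | hk
    · exact length_leaves_pos t
    · exact hs k hk

lemma exists_leaves_eq : ∀ l : List α, l ≠ [] → ∃ t : FreeMagma α, leaves t = l := by
  intro l
  induction l with
  | nil => simp
  | cons a l ih =>
    intro _
    by_cases h : l = []
    · exact ⟨.of a, by simp [h]⟩
    · obtain ⟨t, ht⟩ := ih h
      exact ⟨.of a * t, by simp [ht]⟩

lemma exists_blocks_eq (l : List ℕ) : ∀ L : List α, L.length = l.sum + 1 → (∀ k ∈ l, 0 < k) →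
    ∃ t : FreeMagma α, leaves t = L ∧ blocks t = l := by
  induction l with
  | nil =>
    intro L hL _
    obtain ⟨a, rfl⟩ := List.length_eq_one_iff.1 hL
    exact ⟨.of a, rfl, rfl⟩
  | cons k l ih =>
    intro L hL hpos
    rw [List.sum_cons] at hL
    obtain ⟨s, hs, hs'⟩ := ih (L.take (l.sum + 1)) (by rw [List.length_take]; omega)
      fun j hj => hpos j (List.mem_cons_of_mem _ hj)
    have hk : (L.drop (l.sum + 1)).length = k := by rw [List.length_drop]; omega
    have := hpos k List.mem_cons_self
    obtain ⟨t, ht⟩ := exists_leaves_eq (L.drop (l.sum + 1)) (by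
      rw [← List.length_pos_iff]; omega)
    exact ⟨s * t, by rw [leaves_mul, hs, ht, List.take_append_drop],
      by rw [blocks_mul, hs', ht, hk]⟩

lemma eq_of_of_blocks_eq_nil {t : FreeMagma α} (h : blocks t = []) : ∃ a, t = FreeMagma.of a := by
  cases t with
  | of a => exact ⟨a, rfl⟩
  | mul s t => exact absurd h (List.cons_ne_nil _ _)

lemma mul_foldr_congr {c c' : A} (h : ∀ b : A, b * c = b * c') (l : List A) (a : A) :
    a * l.foldr (· * ·) c = a * l.foldr (· * ·) c' := by
  induction l generalizing a with
  | nil => exact h a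
  | cons b l ih => rw [List.foldr_cons, List.foldr_cons, ih]

lemma InA.mul_lift_mul (hA : InA A) (v : α → A) (t : FreeMagma α) (a c : A) :
    a * (FreeMagma.lift v t * c) = a * ((leaves t).map v).foldr (· * ·) c := by
  induction t generalizing a c with
  | ih1 x => rfl
  | ih2 s t hs ht =>
    rw [map_mul, ← hA, hs, leaves_mul, List.map_append, List.foldr_append]
    exact mul_foldr_congr (fun b => ht b c) _ _

lemma InA.mul_lift (hA : InA A) (v : α → A) (t : FreeMagma α) {l : List α} {b : α}
    (h : leaves t = l ++ [b]) (a : A) :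
    a * FreeMagma.lift v t = a * (l.map v).foldr (· * ·) (v b) := by
  induction t generalizing a l b with
  | ih1 x =>
    obtain ⟨rfl, hb⟩ := List.append_inj' (s₁ := []) h rfl
    obtain rfl := List.singleton_inj.1 hb
    rfl
  | ih2 s t hs ht =>
    obtain ⟨l', b', h'⟩ : ∃ l' b', leaves t = l' ++ [b'] :=
      ⟨_, _, (List.dropLast_append_getLast (leaves_ne_nil t)).symm⟩
    rw [leaves_mul, h', ← List.append_assoc] at h
    obtain ⟨rfl, hb⟩ := List.append_inj' h rfl
    obtain rfl := List.singleton_inj.1 hb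
    rw [map_mul, hA.mul_lift_mul, List.map_append, List.foldr_append]
    exact mul_foldr_congr (fun b => ht h' b) _ _

lemma InA.mul_lift_congr (hA : InA A) (v : α → A) {s t : FreeMagma α} (h : leaves s = leaves t)
    (a : A) : a * FreeMagma.lift v s = a * FreeMagma.lift v t := by
  have h' := (List.dropLast_append_getLast (leaves_ne_nil t)).symm
  rw [hA.mul_lift v t h', hA.mul_lift v s (h.trans h')]

/-- In `𝒜` the value of a term depends only on its variables and on its blocks. -/
lemma InA.lift_eq_of_blocks_eq (hA : InA A) (v : α → A) {s t : FreeMagma α}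
    (h : leaves s = leaves t) (hb : blocks s = blocks t) :
    FreeMagma.lift v s = FreeMagma.lift v t := by
  induction s generalizing t with
  | ih1 a =>
    obtain ⟨b, rfl⟩ := eq_of_of_blocks_eq_nil hb.symm
    rw [leaves_of, leaves_of, List.singleton_inj] at h
    rw [h]
  | ih2 s₁ s₂ h₁ _ =>
    cases t with
    | of b => exact absurd hb (List.cons_ne_nil _ _)
    | mul t₁ t₂ =>
      change blocks (s₁ * s₂) = blocks (t₁ * t₂) at hb
      change leaves (s₁ * s₂) = leaves (t₁ * t₂) at h
      change _ = FreeMagma.lift v (t₁ * t₂)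
      rw [blocks_mul, blocks_mul, List.cons.injEq] at hb
      obtain ⟨e₁, e₂⟩ := List.append_inj' h hb.1
      rw [map_mul, map_mul, h₁ e₁ hb.2, hA.mul_lift_congr v e₂]

/-- Two terms with the same variables but last blocks of different lengths induce different term
functions, except in semigroups. -/
lemma isSemigroup_of_lift_eq (hA : InA A) (idem : ∀ x : A, x * x = x)
    (hAB : InB A ∨ ∀ x z : A, x * (x * z) = x) {s₁ s₂ t₁ t₂ : FreeMagma α}
    (hl : leaves (s₁ * s₂) = leaves (t₁ * t₂)) (hnd : (leaves (s₁ * s₂)).Nodup)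
    (hlt : (leaves s₂).length < (leaves t₂).length)
    (h : ∀ v : α → A, FreeMagma.lift v (s₁ * s₂) = FreeMagma.lift v (t₁ * t₂)) :
    IsSemigroup A := by
  classical
  obtain ⟨m, hm₁, hm₂⟩ : ∃ m, leaves s₁ = leaves t₁ ++ m ∧ leaves t₂ = m ++ leaves s₂ := by
    rw [leaves_mul, leaves_mul] at hl
    rcases List.append_eq_append_iff.1 hl with ⟨m, h1, h2⟩ | ⟨m, h1, h2⟩
    · rw [h2, List.length_append] at hlt
      omega
    · exact ⟨m, h1, h2⟩
  have hm : m ≠ [] := by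
    rintro rfl
    rw [hm₂] at hlt
    simp at hlt
  obtain ⟨u, rfl⟩ := exists_leaves_eq m hm
  have hnd' := hnd
  rw [leaves_mul, hm₁, List.append_assoc, List.nodup_append, List.nodup_append] at hnd'
  obtain ⟨-, ⟨-, -, d₂⟩, d₁⟩ := hnd'
  have d₁u : ∀ a ∈ leaves u, a ∉ leaves t₁ := fun a ha hb =>
    d₁ a hb a (List.mem_append_left _ ha) rfl
  have d₁s : ∀ a ∈ leaves s₂, a ∉ leaves t₁ := fun a ha hb =>
    d₁ a hb a (List.mem_append_right _ ha) rfl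
  have d₂' : ∀ a ∈ leaves s₂, a ∉ leaves u := fun a ha hb => d₂ a hb a ha rfl
  have key : ∀ x y z : A,
      FreeMagma.lift (fun a => if a ∈ leaves t₁ then x else y) s₁ * z = x * (y * z) := by
    intro x y z
    let v : α → A := fun a => if a ∈ leaves t₁ then x else if a ∈ leaves u then y else z
    have hs₂ : FreeMagma.lift v s₂ = z := lift_eq_of_forall idem fun a ha => by
      simp only [v, d₁s a ha, d₂' a ha, if_false]
    have ht₁ : FreeMagma.lift v t₁ = x := lift_eq_of_forall idem fun a ha => by
      simp only [v, ha, if_true]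
    have hu : FreeMagma.lift v u = y := lift_eq_of_forall idem fun a ha => by
      simp only [v, d₁u a ha, ha, if_true, if_false]
    have hs₁ : FreeMagma.lift v s₁ = FreeMagma.lift (fun a => if a ∈ leaves t₁ then x else y) s₁ :=
      lift_congr fun a ha => by
        rw [hm₁, List.mem_append] at ha
        by_cases c : a ∈ leaves t₁
        · simp only [v, c, if_true]
        · simp only [v, c, ha.resolve_left c, if_true, if_false]
    have := h v
    rw [map_mul, map_mul, hs₁, hs₂, ht₁, hA.mul_lift_congr v (t := u * s₂) hm₂, map_mul, hu,
      hs₂] at this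
    exact this
  rcases hAB with hB | habs
  · intro x y z
    rw [← key, hB.lift_ite, if_pos, if_neg]
    · intro hall
      have := leftmost_mem_leaves u
      exact d₁u _ this (hall _ (by rw [hm₁]; exact List.mem_append_right _ this))
    · have : leftmost s₁ = leftmost t₁ := by
        have e := congrArg List.head? hm₁
        rw [List.head?_append, head?_leaves, head?_leaves] at e
        exact Option.some.inj e
      rw [this]
      exact leftmost_mem_leaves t₁
  · have e : ∀ x z : A, x * z = x := fun x z => by
      have := key x x z
      rw [habs, lift_eq_of_forall idem fun a _ => ite_self x] at this
      exact this
    intro x y z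
    rw [e, e, e]

/-- Outside semigroups, terms without repeated variables are determined by their blocks. -/
lemma blocks_eq_of_lift_eq (hns : ¬ IsSemigroup A) (hA : InA A) (idem : ∀ x : A, x * x = x)
    (hAB : InB A ∨ ∀ x z : A, x * (x * z) = x) {s t : FreeMagma α}
    (hl : leaves s = leaves t) (hnd : (leaves s).Nodup)
    (h : ∀ v : α → A, FreeMagma.lift v s = FreeMagma.lift v t) : blocks s = blocks t := by
  classical
  induction s generalizing t with
  | ih1 a =>
    cases t with
    | of b => rfl
    | mul t₁ t₂ =>
      have := congrArg List.length hl
      change 1 = (leaves t₁ ++ leaves t₂).length at this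
      have h1 := length_leaves_pos t₁
      have h2 := length_leaves_pos t₂
      rw [List.length_append] at this
      omega
  | ih2 s₁ s₂ ih _ =>
    cases t with
    | of b =>
      have := congrArg List.length hl
      change (leaves s₁ ++ leaves s₂).length = 1 at this
      have h1 := length_leaves_pos s₁
      have h2 := length_leaves_pos s₂
      rw [List.length_append] at this
      omega
    | mul t₁ t₂ =>
      change leaves (s₁ * s₂) = leaves (t₁ * t₂) at hl
      change ∀ v : α → A, FreeMagma.lift v (s₁ * s₂) = FreeMagma.lift v (t₁ * t₂) at h
      change blocks (s₁ * s₂) = blocks (t₁ * t₂)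
      rcases lt_trichotomy (leaves s₂).length (leaves t₂).length with hlt | heq | hlt
      · exact absurd (isSemigroup_of_lift_eq hA idem hAB hl hnd hlt h) hns
      · obtain ⟨e₁, e₂⟩ := List.append_inj' hl heq
        rw [leaves_mul, List.nodup_append] at hnd
        rw [blocks_mul, blocks_mul, heq, ih e₁ hnd.1 fun v => ?_]
        let c := FreeMagma.lift v s₁
        let w : α → A := fun a => if a ∈ leaves s₁ then v a else c
        have hs₁ : FreeMagma.lift w s₁ = FreeMagma.lift v s₁ := lift_congr fun a ha => if_pos ha
        have ht₁ : FreeMagma.lift w t₁ = FreeMagma.lift v t₁ :=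
          lift_congr fun a ha => if_pos (e₁ ▸ ha)
        have hs₂ : FreeMagma.lift w s₂ = c := lift_eq_of_forall idem fun a ha =>
          if_neg fun hb => hnd.2.2 a hb a ha rfl
        have ht₂ : FreeMagma.lift w t₂ = c := lift_eq_of_forall idem fun a ha =>
          if_neg fun hb => hnd.2.2 a hb a (e₂ ▸ ha) rfl
        have := h w
        rw [map_mul, map_mul, hs₁, ht₁, hs₂, ht₂, idem] at this
        refine this.trans ?_
        rw [hA.mul_lift_congr v e₁, idem]
      · exact absurd (isSemigroup_of_lift_eq hA idem hAB hl.symm (hl ▸ hnd) hlt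
          fun v => (h v).symm) hns

lemma spectrum_eq_of_inA (hns : ¬ IsSemigroup A) (hA : InA A) (idem : ∀ x : A, x * x = x)
    (hAB : InB A ∨ ∀ x z : A, x * (x * z) = x) {n : ℕ} (hn : 2 ≤ n) :
    spectrum A n = 2 ^ (n - 2) := by
  have hcard : Fintype.card (Composition (n - 1)) = 2 ^ (n - 2) := composition_card _
  rw [spectrum, ← hcard, ← Nat.card_eq_fintype_card, ← Nat.card_coe_set_eq]
  have hex : ∀ c : Composition (n - 1), ∃ t : FreeMagma (Fin n),
      leaves t = List.finRange n ∧ blocks t = c.blocks := fun c =>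
    exists_blocks_eq _ _ (by rw [List.length_finRange, c.blocks_sum]; omega)
      fun k hk => c.blocks_pos hk
  choose T hT hT' using hex
  refine (Nat.card_congr (Equiv.ofBijective
    (fun c : Composition (n - 1) => (⟨termFun A (T c), T c, hT c, rfl⟩ :
      termFun A '' bracketings n)) ⟨fun c d hcd => ?_, ?_⟩)).symm
  · have := congrFun (congrArg Subtype.val hcd)
    ext1
    rw [← hT', ← hT']
    exact blocks_eq_of_lift_eq hns hA idem hAB ((hT c).trans (hT d).symm)
      (by rw [hT]; exact List.nodup_finRange n) this
  · rintro ⟨_, t, ht, rfl⟩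
    have ht' : leaves t = List.finRange n := ht
    refine ⟨⟨blocks t, fun {k} hk => blocks_pos t k hk, ?_⟩, ?_⟩
    · have := sum_blocks t
      rw [ht', List.length_finRange] at this
      omega
    · refine Subtype.ext (funext fun v => ?_)
      exact hA.lift_eq_of_blocks_eq v ((hT _).trans ht'.symm) (hT' _)

lemma InC.inA {p : ℕ} (hC : InC p A) : InA A := fun x y z u => by
  rw [hC.left, hC.left, hC.left]

lemma InOneOf.spectrum_eq (h : InOneOf A) (hns : ¬ IsSemigroup A) {n : ℕ} (hn : 2 ≤ n) :
    spectrum A n = 2 ^ (n - 2) := by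
  rcases h with ⟨hB, hA⟩ | ⟨p, -, hC⟩ | ⟨hD, hA⟩
  · exact spectrum_eq_of_inA hns hA hB.idem (Or.inl hB) hn
  · exact spectrum_eq_of_inA hns hC.inA hC.idem
      (Or.inr fun x z => by rw [hC.left, hC.idem]) hn
  · exact spectrum_eq_of_inA hns hA hD.idem (Or.inr fun x z => hD.absorb x [z]) hn

lemma InOneOf.idem (h : InOneOf A) : IsIdempotent A := by
  rcases h with ⟨hB, -⟩ | ⟨p, -, hC⟩ | ⟨hD, -⟩
  · exact hB.idem
  · exact hC.idem
  · exact hD.idem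

end Spectrum
section Duality

variable {α : Type*} {A : Type*}

/-- The mirror image of a term. -/
def mirror : FreeMagma α → FreeMagma α
  | FreeMagma.of a => FreeMagma.of a
  | FreeMagma.mul s t => FreeMagma.mul (mirror t) (mirror s)

lemma leaves_mirror (t : FreeMagma α) : leaves (mirror t) = (leaves t).reverse := by
  induction t with
  | ih1 a => rfl
  | ih2 s t hs ht =>
    change leaves (mirror t) ++ leaves (mirror s) = (leaves s ++ leaves t).reverse
    rw [hs, ht, List.reverse_append]

lemma leaves_map {β : Type*} (f : α → β) (t : FreeMagma α) :
    leaves (FreeMagma.map f t) = (leaves t).map f := by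
  induction t with
  | ih1 a => rfl
  | ih2 s t hs ht => rw [map_mul, leaves_mul, leaves_mul, hs, ht, List.map_append]

lemma lift_mirror [Mul A] (v : α → A) (t : FreeMagma α) :
    FreeMagma.lift v (mirror t) = @FreeMagma.lift α A (flipMul A) v t := by
  induction t with
  | ih1 a => rfl
  | ih2 s t hs ht =>
    change FreeMagma.lift v (mirror t) * FreeMagma.lift v (mirror s) =
      @FreeMagma.lift α A (flipMul A) v t * @FreeMagma.lift α A (flipMul A) v s
    rw [hs, ht]

lemma lift_map [Mul A] {β : Type*} (f : α → β) (v : β → A) (t : FreeMagma α) :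
    FreeMagma.lift v (FreeMagma.map f t) = FreeMagma.lift (v ∘ f) t := by
  induction t with
  | ih1 a => rfl
  | ih2 s t hs ht => rw [map_mul, map_mul, map_mul, hs, ht]

lemma image_termFun_flipMul_subset [Mul A] (n : ℕ) :
    @termFun A (flipMul A) n '' bracketings n ⊆
      (fun f v => f (v ∘ Fin.rev)) '' (termFun A '' bracketings n) := by
  rintro _ ⟨t, ht, rfl⟩
  refine ⟨_, ⟨FreeMagma.map Fin.rev (mirror t), ?_, rfl⟩, funext fun v => ?_⟩
  · change leaves _ = _
    rw [leaves_map, leaves_mirror, show leaves t = List.finRange n from ht, List.map_reverse,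
      ← List.finRange_reverse, List.reverse_reverse]
  · change FreeMagma.lift _ (FreeMagma.map Fin.rev (mirror t)) = _
    rw [lift_map, lift_mirror]
    simp [Function.comp_def, termFun]

lemma spectrum_flipMul_le [Mul A] (n : ℕ) : @spectrum A (flipMul A) n ≤ spectrum A n :=
  (Set.ncard_le_ncard (image_termFun_flipMul_subset n)
    (((finite_bracketings n).image _).image _)).trans
    (Set.ncard_image_le ((finite_bracketings n).image _))

lemma spectrum_flipMul [Mul A] (n : ℕ) : @spectrum A (flipMul A) n = spectrum A n :=
  (spectrum_flipMul_le n).antisymm (@spectrum_flipMul_le A (flipMul A) n)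

lemma isSemigroup_flipMul [Mul A] : @IsSemigroup A (flipMul A) ↔ IsSemigroup A :=
  ⟨fun h x y z => (h z y x).symm, fun h x y z => (h z y x).symm⟩

lemma hasMinimalClone_flipMul [Mul A] : @HasMinimalClone A (flipMul A) ↔ HasMinimalClone A := by
  unfold HasMinimalClone
  rw [cloneOf_flipMul]

lemma InOneOf.of_mulEquiv {B : Type*} [Mul A] [Mul B] (e : A ≃* B) (h : InOneOf A) :
    InOneOf B := by
  have hA : InA A → InA B := fun h x y z u => e.symm.injective (by simpa using h _ _ _ _)
  have hfold : ∀ (ys : List B) (x : B), e.symm (ys.foldl (fun w y => w * y) x) =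
      (ys.map e.symm).foldl (fun w y => w * y) (e.symm x) := by
    intro ys
    induction ys with
    | nil => intro x; rfl
    | cons y ys ih => intro x; rw [List.foldl_cons, ih, map_mul]; rfl
  rcases h with ⟨hB, h⟩ | ⟨p, hp, hC⟩ | ⟨hD, h⟩
  · refine Or.inl ⟨⟨?_, ?_, ?_, ?_, ?_, ?_⟩, hA h⟩ <;> intros <;> apply e.symm.injective <;>
      simp only [map_mul, hB.idem, hB.left_left, hB.left_right, hB.right_left, hB.right_right,
        hB.both]
  · refine Or.inr (Or.inl ⟨p, hp, ⟨?_, ?_, ?_, ?_⟩⟩) <;> intros <;> apply e.symm.injective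
    · simp only [map_mul, hC.idem]
    · simp only [map_mul, hC.left]
    · rw [map_mul, map_mul, hC.right, map_mul, map_mul]
    · rename_i x y
      refine Eq.trans ?_ (hC.cyclic (e.symm x) (e.symm y))
      exact (Function.Semiconj.iterate_right (f := e.symm) (ga := fun w => w * y)
        (gb := fun w => w * e.symm y) (fun w => map_mul _ _ _) p) x
  · refine Or.inr (Or.inr ⟨⟨?_, ?_, ?_, ?_, ?_⟩, hA h⟩) <;> intros <;> apply e.symm.injective <;>
      simp only [map_mul, hfold, hD.left_right, hD.right_left, hD.right_right, hD.both, hD.absorb]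

/-- The dual, realized on the same type. -/
def flipEquiv (A : Type*) [Mul A] : @MulEquiv A Aᵐᵒᵖ (flipMul A) _ :=
  @MulEquiv.mk A Aᵐᵒᵖ (flipMul A) _ MulOpposite.opEquiv fun _ _ => rfl

lemma inOneOf_mulOpposite [Mul A] : InOneOf Aᵐᵒᵖ ↔ @InOneOf A (flipMul A) :=
  ⟨fun h => @InOneOf.of_mulEquiv _ _ _ (flipMul A) (@MulEquiv.symm _ _ (flipMul A) _ (flipEquiv A)) h,
    fun h => @InOneOf.of_mulEquiv _ _ (flipMul A) _ (flipEquiv A) h⟩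

end Duality

section Main

variable {A : Type*} [Mul A]

/-- If the five bracketings of four factors are not pairwise different, then one of ten identities
holds. -/
lemma identity_of_spectrum_lt (h : spectrum A 4 < 5) :
    (∀ x y z u : A, x * (y * (z * u)) = x * ((y * z) * u)) ∨
    (∀ x y z u : A, x * (y * (z * u)) = (x * y) * (z * u)) ∨
    (∀ x y z u : A, x * (y * (z * u)) = (x * (y * z)) * u) ∨
    (∀ x y z u : A, x * (y * (z * u)) = ((x * y) * z) * u) ∨
    (∀ x y z u : A, x * ((y * z) * u) = (x * y) * (z * u)) ∨
    (∀ x y z u : A, x * ((y * z) * u) = (x * (y * z)) * u) ∨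
    (∀ x y z u : A, x * ((y * z) * u) = ((x * y) * z) * u) ∨
    (∀ x y z u : A, (x * y) * (z * u) = (x * (y * z)) * u) ∨
    (∀ x y z u : A, (x * y) * (z * u) = ((x * y) * z) * u) ∨
    (∀ x y z u : A, (x * (y * z)) * u = ((x * y) * z) * u) := by
  classical
  let F : Fin 5 → FreeMagma (Fin 4) := ![.of 0 * (.of 1 * (.of 2 * .of 3)),
    .of 0 * ((.of 1 * .of 2) * .of 3), (.of 0 * .of 1) * (.of 2 * .of 3),
    (.of 0 * (.of 1 * .of 2)) * .of 3, ((.of 0 * .of 1) * .of 2) * .of 3]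
  have hF : ∀ i, F i ∈ bracketings 4 := by
    intro i
    fin_cases i <;> rfl
  have hni : ¬ Function.Injective fun i => termFun A (F i) := by
    intro hinj
    have h5 : (Set.range fun i => termFun A (F i)).ncard = 5 := by
      rw [← Set.image_univ, Set.ncard_image_of_injective _ hinj, Set.ncard_univ, Nat.card_fin]
    have hle : (Set.range fun i => termFun A (F i)).ncard ≤ spectrum A 4 :=
      Set.ncard_le_ncard (by rintro _ ⟨i, rfl⟩; exact ⟨F i, hF i, rfl⟩)
        ((finite_bracketings 4).image _)
    omega
  have hlt : ∃ i j, i < j ∧ termFun A (F i) = termFun A (F j) := by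
    simp only [Function.Injective, not_forall] at hni
    obtain ⟨i, j, hij, hne⟩ := hni
    rcases lt_or_gt_of_ne hne with hlt | hlt
    · exact ⟨i, j, hlt, hij⟩
    · exact ⟨j, i, hlt, hij.symm⟩
  obtain ⟨i, j, hij, he⟩ := hlt
  have key : ∀ x y z u : A, FreeMagma.lift ![x, y, z, u] (F i) =
      FreeMagma.lift ![x, y, z, u] (F j) := fun x y z u => congrFun he _
  fin_cases i <;> fin_cases j <;> first
    | exact absurd hij (by decide)
    | exact Or.inl key
    | exact Or.inr (Or.inl key)
    | exact Or.inr (Or.inr (Or.inl key))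
    | exact Or.inr (Or.inr (Or.inr (Or.inl key)))
    | exact Or.inr (Or.inr (Or.inr (Or.inr (Or.inl key))))
    | exact Or.inr (Or.inr (Or.inr (Or.inr (Or.inr (Or.inl key)))))
    | exact Or.inr (Or.inr (Or.inr (Or.inr (Or.inr (Or.inr (Or.inl key))))))
    | exact Or.inr (Or.inr (Or.inr (Or.inr (Or.inr (Or.inr (Or.inr (Or.inl key)))))))
    | exact Or.inr (Or.inr (Or.inr (Or.inr (Or.inr (Or.inr (Or.inr (Or.inr (Or.inl key))))))))
    | exact Or.inr (Or.inr (Or.inr (Or.inr (Or.inr (Or.inr (Or.inr (Or.inr (Or.inr key))))))))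

lemma IsSemigroup.mul_lift {α : Type*} (h : IsSemigroup A) (v : α → A) (t : FreeMagma α) (c : A) :
    c * FreeMagma.lift v t = (leaves t).foldl (fun w a => w * v a) c := by
  induction t generalizing c with
  | ih1 a => rfl
  | ih2 s t hs ht => rw [map_mul, ← h, hs, ht, leaves_mul, List.foldl_append]

lemma IsSemigroup.lift_eq_foldl {α : Type*} (h : IsSemigroup A) (v : α → A) (t : FreeMagma α) :
    FreeMagma.lift v t = (leaves t).tail.foldl (fun w a => w * v a) (v (leftmost t)) := by
  induction t with
  | ih1 a => rfl
  | ih2 s t hs _ =>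
    rw [map_mul, h.mul_lift, hs, leaves_mul, List.tail_append_of_ne_nil (leaves_ne_nil s),
      List.foldl_append, leftmost_mul]

lemma IsSemigroup.spectrum_le_one (h : IsSemigroup A) (n : ℕ) : spectrum A n ≤ 1 := by
  have key : ∀ {s t : FreeMagma (Fin n)}, leaves s = leaves t → termFun A s = termFun A t := by
    intro s t hst
    have hl := congrArg List.head? hst
    rw [head?_leaves, head?_leaves] at hl
    funext v
    unfold termFun
    rw [h.lift_eq_foldl, h.lift_eq_foldl, hst, Option.some.inj hl]
  refine (Set.ncard_le_one ((finite_bracketings n).image _)).2 ?_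
  rintro _ ⟨s, hs, rfl⟩ _ ⟨t, ht, rfl⟩
  exact key (Eq.trans hs ht.symm)

lemma inOneOf_of_minimal (hmin : HasMinimalClone A) (idem : ∀ x : A, x * x = x)
    (hns : ¬ IsSemigroup A) (h5 : spectrum A 4 < 5) :
    InOneOf A ∨ @InOneOf A (flipMul A) := by
  have hmin' := hasMinimalClone_flipMul.2 hmin
  have hns' := mt isSemigroup_flipMul.1 hns
  rcases identity_of_spectrum_lt h5 with h | h | h | h | h | h | h | h | h | h
  · exact Or.inl ((inOneOf_of_inA hmin idem h).resolve_left hns)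
  · refine absurd (fun x y z => ?_) hns
    have := h x y z z
    rw [idem] at this
    exact this.symm
  · exact absurd (semigroup_of_right_eq_inner hmin idem h) hns
  · exact absurd (semigroup_of_right_eq_left idem h) hns
  · exact absurd (semigroup_of_mul_mul_mul_eq_pair idem h) hns
  · refine absurd (fun x y z => ?_) hns
    have := h x y y z
    rw [idem] at this
    exact this.symm
  · exact absurd (@semigroup_of_right_eq_inner A (flipMul A) hmin' idem
      fun x y z u => (h u z y x).symm) hns'
  · exact absurd (@semigroup_of_mul_mul_mul_eq_pair A (flipMul A) idem
      fun x y z u => (h u z y x).symm) hns'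
  · refine absurd (fun x y z => ?_) hns
    have := h x x y z
    rw [idem] at this
    exact this.symm
  · exact Or.inr ((@inOneOf_of_inA A (flipMul A) hmin' idem
      fun x y z u => (h u z y x).symm).resolve_left hns')

end Main

end MinClone

theorem theorem2p8 (A : Type*) [Mul A] :
    ((MinClone.IsIdempotent A ∧ MinClone.HasMinimalClone A ∧
        1 < MinClone.spectrum A 4 ∧ MinClone.spectrum A 4 < 5) ↔
      (¬ MinClone.IsSemigroup A ∧ (MinClone.InOneOf A ∨ MinClone.InOneOf Aᵐᵒᵖ))) ∧
    ((¬ MinClone.IsSemigroup A ∧ (MinClone.InOneOf A ∨ MinClone.InOneOf Aᵐᵒᵖ)) →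
      ∀ n : ℕ, 2 ≤ n → MinClone.spectrum A n = 2 ^ (n - 2)) := by
  open MinClone in
  have hspec : (¬ IsSemigroup A ∧ (InOneOf A ∨ InOneOf Aᵐᵒᵖ)) →
      ∀ n : ℕ, 2 ≤ n → spectrum A n = 2 ^ (n - 2) := by
    rintro ⟨hns, h | h⟩ n hn
    · exact h.spectrum_eq hns hn
    · rw [← spectrum_flipMul]
      exact @InOneOf.spectrum_eq A (flipMul A) (inOneOf_mulOpposite.1 h)
        (mt isSemigroup_flipMul.1 hns) n hn
  refine ⟨⟨?_, fun h => ?_⟩, hspec⟩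
  · rintro ⟨idem, hmin, h1, h5⟩
    have hns : ¬ IsSemigroup A := fun h => absurd (h.spectrum_le_one 4) (not_le.2 h1)
    refine ⟨hns, ?_⟩
    rw [inOneOf_mulOpposite]
    exact inOneOf_of_minimal hmin idem hns h5
  · have h4 : spectrum A 4 = 4 := hspec h 4 (by norm_num)
    refine ⟨?_, ?_, by omega, by omega⟩
    · rcases h.2 with h | h
      · exact h.idem
      · exact @InOneOf.idem A (flipMul A) (inOneOf_mulOpposite.1 h)
    · rcases h with ⟨hns, h | h⟩
      · exact h.hasMinimalClone hns
      · exact hasMinimalClone_flipMul.1 (@InOneOf.hasMinimalClone A (flipMul A)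
          (inOneOf_mulOpposite.1 h) (mt isSemigroup_flipMul.1 hns))
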